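/- Let $d\ge 1$, and let $(D,\mathscr D(D))$ be a regular symmetric Dirichlet form on $L^2(\mathbb R^d;dx)$ with core $C_c^2(\mathbb R^d)$. Let $V\ge 0$ be a measurable and locally bounded function on $\mathbb R^d$. Consider the form $$D^V(f,f)=D(f,f)+\int_{\mathbb R^d} f^2(x)V(x)\,dx,\qquad \mathscr D(D^V)=\overline{C_c^2(\mathbb R^d)}^{D^V_1},\qquad D^V_1(f,f)=D^V(f,f)+\|f\|_{L^2(\mathbb R^d;dx)}^2,$$ let $(T^V_t)_{t\ge 0}$ be the associated (Feynman–Kac) strongly continuous symmetric contraction semigroup on $L^2(\mathbb R^d;dx)$, and let $(L^V,\mathscr D(L^V))$ be its generator. Assume that $T^V_t$ is compact on $L^2(\mathbb R^d;dx)$ for every $t>0$, and that there is a bounded, continuous, strictly positive ground state $\phi_1$: $\|\phi_1\|_{L^2(\mathbb R^d;dx)}=1$ and $L^V\phi_1=-\lambda_1\phi_1$, where $\lambda_1>0$ is the smallest eigenvalue of $-L^V$. Suppose that $(T^V_t)_{t\ge 0}$ is intrinsically ultracontractive, that is, for every $t>0$ the operator $T_t^V$ has a non-negative measurable kernel $p^V(t,x,y)$,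 and there is a constant $C_t>0$ such that $$p^V(t,x,y)\le C_t\,\phi_1(x)\phi_1(y),\qquad x,y\in\mathbb R^d.$$ Suppose moreover that there are a function $\psi\in C_b^2(\mathbb R^d)\cap L^2(\mathbb R^d;dx)$ with $\psi(x)>0$ for all $x\in\mathbb R^d$ and $\psi\in\mathscr D(L^V)$, and a constant $\lambda>0$, such that $$L^V\psi(x)\le\lambda\,\psi(x)\qquad\text{for almost every }x\in\mathbb R^d .$$ Then there is a constant $c_1>0$ such that $$\phi_1(x)\le c_1\,\psi(x)\qquad\text{for all }x\in\mathbb R^d .$$ -/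

import Mathlib

open MeasureTheory Filter Topology

/-- Euclidean space `ℝᵈ`. -/
abbrev Rd (d : ℕ) : Type := EuclideanSpace ℝ (Fin d)

/-- The real Hilbert space `L²(ℝᵈ; dx)` with respect to Lebesgue measure. -/
abbrev L2 (d : ℕ) : Type := Lp ℝ 2 (volume : Measure (Rd d))

/-- The (classes of) functions of `C_c²(ℝᵈ)`, as a subset of `L²(ℝᵈ; dx)`. -/
def Cc2 (d : ℕ) : Set (L2 d) :=
  {u | ∃ f : Rd d → ℝ, ContDiff ℝ 2 f ∧ HasCompactSupport f ∧ (u : Rd d → ℝ) =ᵐ[volume] f}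

/-- The functions of `C_b²(ℝᵈ)`: twice continuously differentiable, bounded together with the
derivatives of order one and two. -/
def IsCb2 {d : ℕ} (f : Rd d → ℝ) : Prop :=
  ContDiff ℝ 2 f ∧ ∀ k : ℕ, k ≤ 2 → ∃ C : ℝ, ∀ x, ‖iteratedFDeriv ℝ k f x‖ ≤ C

/-- A symmetric Dirichlet form `(D, 𝓓(D))` on `L²(ℝᵈ; dx)`: a densely defined, non-negative
definite, symmetric bilinear form which is closed and on which the unit contraction operates.
Only the values of `form` on `domain` are meaningful. -/
structure DirichletForm (d : ℕ) where
  /-- The domain `𝓓(D)`. -/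
  domain : Submodule ℝ (L2 d)
  /-- The bilinear form `D(u, v)`, for `u` and `v` in the domain. -/
  form : L2 d → L2 d → ℝ
  dense : Dense (domain : Set (L2 d))
  symm : ∀ u ∈ domain, ∀ v ∈ domain, form u v = form v u
  add_left : ∀ u ∈ domain, ∀ v ∈ domain, ∀ w ∈ domain, form (u + v) w = form u w + form v w
  smul_left : ∀ (a : ℝ), ∀ u ∈ domain, ∀ v ∈ domain, form (a • u) v = a * form u v
  nonneg : ∀ u ∈ domain, 0 ≤ form u u
  /-- The domain is complete for the norm `(D(u, u) + ‖u‖²)^{1/2}`. -/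
  closed : ∀ u : ℕ → L2 d, (∀ n, u n ∈ domain) →
    (∀ ε > 0, ∃ N, ∀ m ≥ N, ∀ n ≥ N, form (u m - u n) (u m - u n) + ‖u m - u n‖ ^ 2 < ε) →
    ∃ v ∈ domain, Tendsto (fun n => form (u n - v) (u n - v) + ‖u n - v‖ ^ 2) atTop (𝓝 0)
  /-- Markov property: `(0 ∨ u) ∧ 1` belongs to the domain and does not have larger energy. -/
  markov : ∀ u ∈ domain, ∃ v ∈ domain,
    ((v : Rd d → ℝ) =ᵐ[volume] fun x => min (max (u x) 0) 1) ∧ form v v ≤ form u u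

namespace DirichletForm

variable {d : ℕ}

/-- `C_c²(ℝᵈ)` is a core of the Dirichlet form: it is contained in the domain and dense in it for
the norm `(D(u, u) + ‖u‖²)^{1/2}`. As `C_c²(ℝᵈ)` is always uniformly dense in `C_c(ℝᵈ)`, a
Dirichlet form with this property is regular. -/
def HasCoreCc2 (D : DirichletForm d) : Prop :=
  Cc2 d ⊆ (D.domain : Set (L2 d)) ∧
    ∀ u ∈ D.domain, ∀ ε > 0, ∃ w ∈ Cc2 d, D.form (u - w) (u - w) + ‖u - w‖ ^ 2 < ε

/-- The form with killing `D^V(u, v) = D(u, v) + ∫ u v V dx`. -/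
noncomputable def killedForm (D : DirichletForm d) (V : Rd d → ℝ) (u v : L2 d) : ℝ :=
  D.form u v + ∫ x, u x * v x * V x

/-- The domain `𝓓(D^V)`: the closure of `C_c²(ℝᵈ)` for the norm `(D^V(u, u) + ‖u‖²)^{1/2}`, taken
among the `u ∈ 𝓓(D)` with `∫ u² V dx < ∞`. -/
def killedDomain (D : DirichletForm d) (V : Rd d → ℝ) : Set (L2 d) :=
  {u | u ∈ D.domain ∧ Integrable (fun x => u x * u x * V x) volume ∧
    ∀ ε > 0, ∃ w ∈ Cc2 d, D.killedForm V (u - w) (u - w) + ‖u - w‖ ^ 2 < ε}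

end DirichletForm

/-- `IsGeneratorAt T u f` says that `u` belongs to the domain of the infinitesimal generator `L` of
`(T_t)_{t ≥ 0}` and that `L u = f`, i.e. `(T_t u - u) / t → f` in `L²` as `t ↓ 0`. -/
def IsGeneratorAt {d : ℕ} (T : ℝ → L2 d →L[ℝ] L2 d) (u f : L2 d) : Prop :=
  Tendsto (fun t : ℝ => t⁻¹ • (T t u - u)) (𝓝[>] 0) (𝓝 f)

/-- `(T_t)_{t ≥ 0}` is a strongly continuous symmetric contraction semigroup on `L²(ℝᵈ; dx)`.
The values of `T` at negative times play no role. -/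
structure IsSymmContractionSemigroup {d : ℕ} (T : ℝ → L2 d →L[ℝ] L2 d) : Prop where
  zero : T 0 = ContinuousLinearMap.id ℝ (L2 d)
  add : ∀ s t : ℝ, 0 ≤ s → 0 ≤ t → T (s + t) = (T s).comp (T t)
  symm : ∀ t : ℝ, 0 ≤ t → ∀ u v : L2 d, inner ℝ (T t u) v = inner ℝ u (T t v)
  contraction : ∀ t : ℝ, 0 ≤ t → ∀ u : L2 d, ‖T t u‖ ≤ ‖u‖
  strongly_continuous : ∀ u : L2 d, Tendsto (fun t : ℝ => T t u) (𝓝[>] 0) (𝓝 u)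

/-- `(T_t)_{t ≥ 0}` is the semigroup associated with the form `(D^V, 𝓓(D^V))`: it is the strongly
continuous symmetric contraction semigroup whose generator is the self-adjoint operator `L^V`
associated with the form, i.e. `u ∈ 𝓓(L^V)` and `L^V u = f` if and only if `u ∈ 𝓓(D^V)` and
`D^V(u, v) = -⟨f, v⟩` for all `v ∈ 𝓓(D^V)`. -/
structure IsFeynmanKacSemigroup {d : ℕ} (D : DirichletForm d) (V : Rd d → ℝ)
    (T : ℝ → L2 d →L[ℝ] L2 d) : Prop where
  semigroup : IsSymmContractionSemigroup T
  generator : ∀ u f : L2 d, IsGeneratorAt T u f ↔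
    u ∈ D.killedDomain V ∧ ∀ v ∈ D.killedDomain V, D.killedForm V u v = -inner ℝ f v

/-- `φ` is an eigenfunction, normalized in `L²`, of `-L` for the first (smallest) eigenvalue `lam₁`,
where `L` is the generator of `(T_t)_{t ≥ 0}`. -/
structure IsGroundState {d : ℕ} (T : ℝ → L2 d →L[ℝ] L2 d) (lam₁ : ℝ) (φ : Rd d → ℝ) : Prop where
  memLp : MemLp φ 2 volume
  normalized : ∫ x, φ x ^ 2 = 1
  eigen : IsGeneratorAt T (memLp.toLp φ) (-lam₁ • memLp.toLp φ)
  first : ∀ (lam : ℝ) (u : L2 d), u ≠ 0 → IsGeneratorAt T u (-lam • u) → lam₁ ≤ lam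

/-- Intrinsic ultracontractivity with respect to the ground state `φ`: for every `t > 0`, `T_t` has
a non-negative kernel `p(t, x, y)` and there is `C_t > 0` such that
`p(t, x, y) ≤ C_t φ(x) φ(y)` for all `x`, `y`. -/
def IsIntrinsicallyUltracontractive {d : ℕ} (T : ℝ → L2 d →L[ℝ] L2 d) (φ : Rd d → ℝ) : Prop :=
  ∀ t : ℝ, 0 < t → ∃ p : Rd d → Rd d → ℝ,
    Measurable (Function.uncurry p) ∧ (∀ x y, 0 ≤ p x y) ∧
    (∀ f : L2 d, (T t f : Rd d → ℝ) =ᵐ[volume] fun x => ∫ y, p x y * f y) ∧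
    ∃ C : ℝ, 0 < C ∧ ∀ x y, p x y ≤ C * φ x * φ y

/-!
Write `φ = φ₁` and let `λ₁` be its eigenvalue. The bound follows by comparing three quantities at
time `1`:
`e^{-λ₁} φ ≤ T₁ φ ≤ n T₁ ψ + (e^{-λ₁} / 2) φ ≤ n e^λ ψ + (e^{-λ₁} / 2) φ` almost everywhere.

The outer inequalities are instances of one comparison principle: if `L u ≤ κ u` then
`T_t u ≤ e^{κ t} u` (`IsSymmContractionSemigroup.apply_le_exp_smul`). Indeed, for `g ≥ 0` the
function `t ↦ ⟨T_t u, g⟩` has right derivative `⟨T_t L u, g⟩ ≤ κ ⟨T_t u, g⟩`, since `T_t` preserves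
positivity, and Grönwall's inequality applies.

The middle one (`IsIntrinsicallyUltracontractive.exists_apply_le`) comes from
`φ ≤ n ψ + (φ - n ψ)⁺` and the kernel bound:
`T₁ φ (x) ≤ n T₁ ψ (x) + C φ(x) ∫ φ (φ - n ψ)⁺ dy`, where the integral tends to `0` as `n → ∞` by
dominated convergence, as `ψ > 0`. Continuity of `φ` and `ψ` turns the almost everywhere bound into a pointwise one.
-/

/-- Along a contraction semigroup, the displacement between two times is bounded by the displacement
from time zero over the elapsed time. -/
theorem IsSymmContractionSemigroup.norm_sub_le {d : ℕ} {T : ℝ → L2 d →L[ℝ] L2 d}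
    (hT : IsSymmContractionSemigroup T) (u : L2 d) {s t : ℝ} (hs : 0 ≤ s) (ht : 0 ≤ t) :
    ‖T t u - T s u‖ ≤ ‖T |t - s| u - u‖ := by
  wlog hst : s ≤ t generalizing s t
  · rw [norm_sub_rev, abs_sub_comm]
    exact this ht hs (le_of_not_ge hst)
  have h : T t u = T s (T (t - s) u) := by
    have := hT.add s (t - s) hs (sub_nonneg.2 hst)
    rw [add_sub_cancel] at this
    rw [this]; rfl
  rw [h, ← map_sub, abs_of_nonneg (sub_nonneg.2 hst)]
  exact hT.contraction s hs _

theorem IsSymmContractionSemigroup.continuousOn {d : ℕ} {T : ℝ → L2 d →L[ℝ] L2 d}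
    (hT : IsSymmContractionSemigroup T) (u : L2 d) :
    ContinuousOn (fun t => T t u) (Set.Ici 0) := by
  intro s hs
  have h0 : Tendsto (fun t : ℝ => T t u) (𝓝[≥] 0) (𝓝 u) := by
    have : ContinuousWithinAt (fun t : ℝ => T t u) (Set.Ioi 0) 0 := by
      simpa [ContinuousWithinAt, hT.zero] using hT.strongly_continuous u
    have := (continuousWithinAt_Ioi_iff_Ici.1 this)
    simpa [ContinuousWithinAt, hT.zero] using this
  have habs : Tendsto (fun t : ℝ => |t - s|) (𝓝[Set.Ici 0] s) (𝓝[≥] 0) := by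
    refine tendsto_nhdsWithin_iff.2 ⟨?_, Eventually.of_forall fun t => Set.mem_Ici.2 (abs_nonneg _)⟩
    have : Continuous fun t : ℝ => |t - s| := by fun_prop
    simpa using (this.tendsto s).mono_left nhdsWithin_le_nhds
  have hn : Tendsto (fun t : ℝ => ‖T |t - s| u - u‖) (𝓝[Set.Ici 0] s) (𝓝 0) := by
    simpa using ((h0.comp habs).sub_const u).norm
  refine tendsto_iff_norm_sub_tendsto_zero.2 (squeeze_zero' ?_ ?_ hn)
  · exact Eventually.of_forall fun t => norm_nonneg _
  · filter_upwards [self_mem_nhdsWithin] with t ht using hT.norm_sub_le u hs ht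

theorem IsSymmContractionSemigroup.hasDerivWithinAt {d : ℕ} {T : ℝ → L2 d →L[ℝ] L2 d}
    (hT : IsSymmContractionSemigroup T) {u f : L2 d} (hu : IsGeneratorAt T u f) {t : ℝ}
    (ht : 0 ≤ t) : HasDerivWithinAt (fun s => T s u) (T t f) (Set.Ici t) t := by
  rw [hasDerivWithinAt_iff_tendsto_slope, Set.Ici_sdiff_left]
  have hshift : Tendsto (fun s : ℝ => s - t) (𝓝[>] t) (𝓝[>] 0) := by
    refine tendsto_nhdsWithin_iff.2 ⟨?_, ?_⟩
    · have : Continuous fun s : ℝ => s - t := by fun_prop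
      simpa using (this.tendsto t).mono_left nhdsWithin_le_nhds
    · filter_upwards [self_mem_nhdsWithin] with s hs using
        Set.mem_Ioi.2 (sub_pos.2 (Set.mem_Ioi.1 hs))
  refine (((T t).continuous.tendsto f).comp (hu.comp hshift)).congr' ?_
  filter_upwards [self_mem_nhdsWithin] with s hs
  have h := hT.add t (s - t) ht (sub_nonneg.2 (le_of_lt hs))
  rw [add_sub_cancel] at h
  simp [slope, h]

theorem L2.inner_nonneg {d : ℕ} {f g : L2 d} (hf : 0 ≤ f) (hg : 0 ≤ g) : 0 ≤ inner ℝ f g := by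
  rw [MeasureTheory.L2.inner_def]
  refine integral_nonneg_of_ae ?_
  filter_upwards [(Lp.coeFn_nonneg f).2 hf, (Lp.coeFn_nonneg g).2 hg] with x hx hy
  exact mul_nonneg hy hx

/-- The nonnegative cone of `L²` is self-dual. -/
theorem L2.nonneg_of_forall_inner {d : ℕ} {w : L2 d}
    (h : ∀ g : L2 d, 0 ≤ g → 0 ≤ inner ℝ w g) : 0 ≤ w := by
  have hneg := h (w⁻) (negPart_nonneg w)
  have horth : inner ℝ (w⁺) (w⁻) = 0 := by
    rw [MeasureTheory.L2.inner_def]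
    refine integral_eq_zero_of_ae ?_
    filter_upwards [Lp.coeFn_sup w 0, Lp.coeFn_sup (-w) 0, Lp.coeFn_neg w,
      Lp.coeFn_zero ℝ 2 (volume : Measure (Rd d))] with x h1 h2 h3 h4
    simp only [posPart_def, negPart_def, h1, h2, Pi.sup_apply, h3, h4, Pi.neg_apply, Pi.zero_apply]
    rcases le_total (w x) 0 with hx | hx <;> simp [hx]
  have hw : inner ℝ w (w⁻) = -‖w⁻‖ ^ 2 := by
    rw [← real_inner_self_eq_norm_sq]
    have h := inner_sub_left (𝕜 := ℝ) (w⁺) (w⁻) (w⁻)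
    rwa [posPart_sub_negPart, horth, zero_sub] at h
  have hz : w⁻ = 0 := by
    rw [← norm_eq_zero, ← sq_eq_zero_iff]
    exact le_antisymm (by linarith) (sq_nonneg _)
  exact negPart_eq_zero.1 hz

/-- If `L u ≤ κ u`, a positivity preserving semigroup satisfies `T_t u ≤ e^{κ t} u`. The sign of `κ`
and of `u` is arbitrary. -/
theorem IsSymmContractionSemigroup.apply_le_exp_smul {d : ℕ} {T : ℝ → L2 d →L[ℝ] L2 d}
    (hT : IsSymmContractionSemigroup T) (hpos : ∀ t : ℝ, 0 ≤ t → ∀ f : L2 d, 0 ≤ f → 0 ≤ T t f)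
    {u f : L2 d} (hu : IsGeneratorAt T u f) {κ : ℝ} (hle : f ≤ κ • u) {t : ℝ} (ht : 0 ≤ t) :
    T t u ≤ Real.exp (κ * t) • u := by
  rw [← sub_nonneg]
  refine L2.nonneg_of_forall_inner fun g hg => ?_
  have hcont : ContinuousOn (fun s => inner ℝ (T s u) g) (Set.Icc 0 t) :=
    (((hT.continuousOn u).mono Set.Icc_subset_Ici_self).inner continuousOn_const)
  have hderiv : ∀ s ∈ Set.Ico 0 t,
      HasDerivWithinAt (fun s => inner ℝ (T s u) g) (inner ℝ (T s f) g) (Set.Ici s) s := by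
    intro s hs
    simpa using (hT.hasDerivWithinAt hu hs.1).inner ℝ (hasDerivWithinAt_const s (Set.Ici s) g)
  have hbound : ∀ s ∈ Set.Ico 0 t, inner ℝ (T s f) g ≤ κ * inner ℝ (T s u) g + 0 := by
    intro s hs
    have h := L2.inner_nonneg (hpos s hs.1 _ (sub_nonneg.2 hle)) hg
    rw [map_sub, map_smul, inner_sub_left, real_inner_smul_left] at h
    linarith
  have hgr := le_gronwallBound_of_liminf_deriv_right_le (δ := inner ℝ u g) hcont
    (fun s hs r hr => (hderiv s hs).liminf_right_slope_le hr) (by simp [hT.zero]) hbound t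
    (Set.right_mem_Icc.2 ht)
  rw [gronwallBound_ε0, sub_zero] at hgr
  rw [inner_sub_left, real_inner_smul_left]
  linarith

theorem IsIntrinsicallyUltracontractive.apply_nonneg {d : ℕ} {T : ℝ → L2 d →L[ℝ] L2 d}
    {φ : Rd d → ℝ} (hIU : IsIntrinsicallyUltracontractive T φ) {t : ℝ} (ht : 0 < t) {f : L2 d}
    (hf : 0 ≤ f) : 0 ≤ T t f := by
  obtain ⟨p, -, hp, hTp, -⟩ := hIU t ht
  rw [← Lp.coeFn_nonneg]
  filter_upwards [hTp f] with x hx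
  rw [hx]
  refine integral_nonneg_of_ae ?_
  filter_upwards [(Lp.coeFn_nonneg f).2 hf] with y hy using mul_nonneg (hp x y) hy

/-- Truncating `φ` at the level `n ψ` loses an arbitrarily small part of its `L²` mass, because `ψ`
is strictly positive. -/
theorem tendsto_integral_mul_posPart_sub {d : ℕ} {φ ψ : Rd d → ℝ} (hφ : MemLp φ 2 volume)
    (hψ : MemLp ψ 2 volume) (hφpos : ∀ x, 0 < φ x) (hψpos : ∀ x, 0 < ψ x) :
    Tendsto (fun n : ℕ => ∫ y, φ y * max (φ y - n * ψ y) 0) atTop (𝓝 0) := by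
  rw [show 𝓝 (0 : ℝ) = 𝓝 (∫ _ : Rd d, (0 : ℝ)) by rw [integral_zero]]
  refine tendsto_integral_of_dominated_convergence (fun y => φ y ^ 2) (fun n => ?_)
    hφ.integrable_sq (fun n => ?_) ?_
  · exact hφ.1.mul ((hφ.1.sub (hψ.1.const_mul _)).sup aestronglyMeasurable_const)
  · refine Eventually.of_forall fun y => ?_
    have h1 := hφpos y
    have h2 : 0 ≤ (n : ℝ) * ψ y := mul_nonneg n.cast_nonneg (hψpos y).le
    rw [Real.norm_of_nonneg (mul_nonneg h1.le (le_max_right _ _)), sq]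
    exact mul_le_mul_of_nonneg_left (max_le (by linarith) h1.le) h1.le
  · refine Eventually.of_forall fun y => ?_
    obtain ⟨N, hN⟩ := exists_nat_ge (φ y / ψ y)
    refine tendsto_const_nhds.congr' ?_
    filter_upwards [eventually_ge_atTop N] with n hn
    have h : φ y ≤ n * ψ y := (div_le_iff₀ (hψpos y)).1 (hN.trans (by exact_mod_cast hn))
    rw [max_eq_right (by linarith), mul_zero]

/-- A lower bound for intrinsically ultracontractive semigroups: `T_t φ` is dominated by `T_t ψ`, up
to an arbitrarily small multiple of `φ`. -/
theorem IsIntrinsicallyUltracontractive.exists_apply_le {d : ℕ} {T : ℝ → L2 d →L[ℝ] L2 d}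
    {φ ψ : Rd d → ℝ} (hIU : IsIntrinsicallyUltracontractive T φ) (hφ : MemLp φ 2 volume)
    (hψ : MemLp ψ 2 volume) (hφpos : ∀ x, 0 < φ x) (hψpos : ∀ x, 0 < ψ x) {t : ℝ} (ht : 0 < t)
    {ε : ℝ} (hε : 0 < ε) :
    ∃ n : ℕ, ∀ᵐ x, T t (hφ.toLp φ) x ≤ n * T t (hψ.toLp ψ) x + ε * φ x := by
  obtain ⟨p, hpm, hp, hTp, C, hC, hpC⟩ := hIU t ht
  obtain ⟨n, hn⟩ := ((tendsto_integral_mul_posPart_sub hφ hψ hφpos hψpos).eventually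
    (gt_mem_nhds (div_pos hε hC))).exists
  have hr : MemLp (fun y => max (φ y - n * ψ y) 0) 2 volume := by
    refine hφ.mono ((hφ.1.sub (hψ.1.const_mul _)).sup aestronglyMeasurable_const)
      (Eventually.of_forall fun y => ?_)
    have h2 : 0 ≤ (n : ℝ) * ψ y := mul_nonneg n.cast_nonneg (hψpos y).le
    rw [Real.norm_of_nonneg (le_max_right _ _), Real.norm_of_nonneg (hφpos y).le]
    exact max_le (by linarith) (hφpos y).le
  have hint : ∀ {g : Rd d → ℝ}, MemLp g 2 volume → ∀ x, Integrable (fun y => p x y * g y) := by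
    intro g hg x
    refine ((hφ.integrable_mul hg).const_mul (C * φ x)).mono
      ((hpm.comp measurable_prodMk_left).aestronglyMeasurable.mul hg.1)
      (Eventually.of_forall fun y => ?_)
    have h3 : ‖p x y‖ ≤ C * φ x * φ y := by
      rw [Real.norm_of_nonneg (hp x y)]; exact hpC x y
    have h4 : ‖C * φ x * (φ y * g y)‖ = C * φ x * φ y * ‖g y‖ := by
      rw [← mul_assoc, norm_mul, Real.norm_of_nonneg ((hp x y).trans (hpC x y))]
    simp only [norm_mul (p x y), Pi.mul_apply, h4]
    exact mul_le_mul_of_nonneg_right h3 (norm_nonneg _)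
  refine ⟨n, ?_⟩
  filter_upwards [hTp (hφ.toLp φ), hTp (hψ.toLp ψ)] with x h1 h2
  have e1 : ∫ y, p x y * hφ.toLp φ y = ∫ y, p x y * φ y :=
    integral_congr_ae (by filter_upwards [hφ.coeFn_toLp] with y hy; rw [hy])
  have e2 : ∫ y, p x y * hψ.toLp ψ y = ∫ y, p x y * ψ y :=
    integral_congr_ae (by filter_upwards [hψ.coeFn_toLp] with y hy; rw [hy])
  rw [h1, h2, e1, e2]
  calc ∫ y, p x y * φ y
      ≤ ∫ y, (n * (p x y * ψ y) + C * φ x * (φ y * max (φ y - n * ψ y) 0)) := by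
        refine integral_mono (hint hφ x)
          (((hint hψ x).const_mul _).add ((hφ.integrable_mul hr).const_mul _)) fun y => ?_
        have h3 : p x y * φ y ≤ p x y * (n * ψ y + max (φ y - n * ψ y) 0) :=
          mul_le_mul_of_nonneg_left (by linarith [le_max_left (φ y - n * ψ y) 0]) (hp x y)
        have h4 := mul_le_mul_of_nonneg_right (hpC x y) (le_max_right (φ y - n * ψ y) 0)
        simp only
        linarith
    _ = n * (∫ y, p x y * ψ y) + C * φ x * ∫ y, φ y * max (φ y - n * ψ y) 0 := by
        rw [← integral_const_mul, ← integral_const_mul]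
        exact integral_add ((hint hψ x).const_mul _) ((hφ.integrable_mul hr).const_mul _)
    _ ≤ n * (∫ y, p x y * ψ y) + ε * φ x := by
        have h5 := mul_le_mul_of_nonneg_right ((lt_div_iff₀ hC).1 hn).le (hφpos x).le
        linarith

theorem proposition2p3 (d : ℕ) (hd : 1 ≤ d)
    (D : DirichletForm d) (hcore : D.HasCoreCc2)
    (V : Rd d → ℝ) (hVmeas : Measurable V) (hVnonneg : ∀ x, 0 ≤ V x)
    (hVbdd : ∀ K : Set (Rd d), IsCompact K → ∃ C : ℝ, ∀ x ∈ K, V x ≤ C)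
    (T : ℝ → L2 d →L[ℝ] L2 d) (hT : IsFeynmanKacSemigroup D V T)
    (hcompact : ∀ t : ℝ, 0 < t → IsCompactOperator (T t))
    (lam₁ : ℝ) (hlam₁ : 0 < lam₁) (φ₁ : Rd d → ℝ) (hφ₁ : IsGroundState T lam₁ φ₁)
    (hφ₁cont : Continuous φ₁) (hφ₁bdd : ∃ C : ℝ, ∀ x, φ₁ x ≤ C) (hφ₁pos : ∀ x, 0 < φ₁ x)
    (hIU : IsIntrinsicallyUltracontractive T φ₁)
    (ψ : Rd d → ℝ) (hψpos : ∀ x, 0 < ψ x) (hψCb2 : IsCb2 ψ) (hψL2 : MemLp ψ 2 volume)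
    (lam : ℝ) (hlam : 0 < lam)
    (Lψ : L2 d) (hψdom : IsGeneratorAt T (hψL2.toLp ψ) Lψ)
    (hψle : ∀ᵐ x ∂(volume : Measure (Rd d)), Lψ x ≤ lam * ψ x) :
    ∃ c₁ : ℝ, 0 < c₁ ∧ ∀ x, φ₁ x ≤ c₁ * ψ x := by
  have hpos : ∀ t : ℝ, 0 ≤ t → ∀ f : L2 d, 0 ≤ f → 0 ≤ T t f := by
    intro t ht f hf
    rcases ht.eq_or_lt with rfl | ht
    · simpa [hT.semigroup.zero] using hf
    · exact hIU.apply_nonneg ht hf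
  have hφ := hφ₁.memLp
  have hup : T 1 (hψL2.toLp ψ) ≤ Real.exp (lam * 1) • hψL2.toLp ψ := by
    refine hT.semigroup.apply_le_exp_smul hpos hψdom ?_ zero_le_one
    rw [← Lp.coeFn_le]
    filter_upwards [hψle, hψL2.coeFn_toLp, Lp.coeFn_smul lam (hψL2.toLp ψ)] with x h1 h2 h3
    rw [h3, Pi.smul_apply, h2]
    exact h1
  -- The reverse inequality `e^{-λ₁} φ₁ ≤ T₁ φ₁` is the same comparison, applied to `-φ₁`.
  have hdown : T 1 (-hφ.toLp φ₁) ≤ Real.exp (-lam₁ * 1) • -hφ.toLp φ₁ := by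
    have hgen : IsGeneratorAt T (-hφ.toLp φ₁) (-lam₁ • -hφ.toLp φ₁) := by
      have h := hφ₁.eigen.neg
      rw [← smul_neg] at h
      refine h.congr fun t => ?_
      rw [map_neg, ← smul_neg]
      congr 1
      abel
    exact hT.semigroup.apply_le_exp_smul hpos hgen le_rfl zero_le_one
  set a := Real.exp (-lam₁ * 1) with ha
  have ha0 : 0 < a := Real.exp_pos _
  obtain ⟨n, hn⟩ := hIU.exists_apply_le hφ hψL2 hφ₁pos hψpos zero_lt_one (half_pos ha0)
  set c := 2 / a * (n * Real.exp (lam * 1)) with hc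
  have hae : ∀ᵐ x, φ₁ x ≤ c * ψ x := by
    rw [map_neg, smul_neg, neg_le_neg_iff] at hdown
    filter_upwards [hn, (Lp.coeFn_le _ _).2 hup, (Lp.coeFn_le _ _).2 hdown, hφ.coeFn_toLp,
      hψL2.coeFn_toLp, Lp.coeFn_smul a (hφ.toLp φ₁),
      Lp.coeFn_smul (Real.exp (lam * 1)) (hψL2.toLp ψ)] with x h1 h2 h3 h4 h5 h6 h7
    rw [h7, Pi.smul_apply, h5, smul_eq_mul] at h2
    rw [h6, Pi.smul_apply, h4, smul_eq_mul] at h3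
    have h8 := mul_le_mul_of_nonneg_left h2 (n.cast_nonneg (α := ℝ))
    have h9 : a / 2 * φ₁ x ≤ n * Real.exp (lam * 1) * ψ x := by linarith
    rw [hc, mul_assoc, div_mul_eq_mul_div, le_div_iff₀ ha0]
    linarith
  -- Two continuous functions, so the inequality holds on a closed set of full measure.
  have hall : ∀ x, φ₁ x ≤ c * ψ x := by
    have hcl : IsClosed {x | φ₁ x ≤ c * ψ x} :=
      isClosed_le hφ₁cont (continuous_const.mul hψCb2.1.continuous)
    have hd : Dense {x | φ₁ x ≤ c * ψ x} := Measure.dense_of_ae hae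
    intro x
    have := hd x
    rwa [hcl.closure_eq] at this
  refine ⟨c, ?_, hall⟩
  exact pos_of_mul_pos_left ((hφ₁pos 0).trans_le (hall 0)) (hψpos 0).le
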